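/- Let $(S,\mathcal B)$ be a standard Borel space, $(\Omega,\mathcal A,P)$ a probability space and $X=(X_1,X_2,\ldots)$ a sequence of $S$-valued random variables on $(\Omega,\mathcal A,P)$. Let $M_b(S)$ be the set of bounded $\mathcal B$-measurable functions $f:S\to\mathbb R$. A random probability measure on $\mathcal B$ is a map $\beta:\Omega\times\mathcal B\to[0,1]$ such that $\beta(\omega,\cdot)$ is a probability measure for each $\omega\in\Omega$ and $\omega\mapsto\beta(\omega,B)$ is $\mathcal A$-measurable for each $B\in\mathcal B$; for $f\in M_b(S)$ write $\beta(f)$ for the random variable $\omega\mapsto\int f(x)\,\beta(\omega,dx)$. For $n\ge 0$ let $\mathcal F_n=\sigma(X_1,\ldots,X_n)$ (with $\mathcal F_0=\{\emptyset,\Omega\}$), and let $\alpha_n$ be a version of the predictive distribution $P(X_{n+1}\in\cdot\mid\mathcal F_n)$, that is, a random probability measure on $\mathcal B$ with $\alpha_n(\cdot,B)=P(X_{n+1}\in B\mid\mathcal F_n)$ a.s. for each $B\in\mathcal B$. Let $\mathcal T=\bigcap_{n\ge 1}\sigma(X_n,X_{n+1},\ldots)$ be the tail $\sigma$-field of $X$.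 Suppose that, for each $f\in M_b(S)$, $\alpha_n(f)$ converges in probability as $n\to\infty$ to some real random variable (which may depend on $f$). Then there is a random probability measure $\alpha$ on $\mathcal B$ such that $\omega\mapsto\alpha(\omega,B)$ is $\mathcal T$-measurable for each $B\in\mathcal B$, and $\alpha_n(f)\to\alpha(f)$ in probability as $n\to\infty$ for each $f\in M_b(S)$. -/

import Mathlib

open MeasureTheory ProbabilityTheory Filter

/-- The σ-field generated by the first `n` variables of the sequence `X 0, X 1, X 2, …`
(so it is trivial for `n = 0`). -/
abbrev pastSigma {Ω S : Type*} [mS : MeasurableSpace S] (X : ℕ → Ω → S) (n : ℕ) :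
    MeasurableSpace Ω :=
  ⨆ i : ℕ, ⨆ _ : i < n, mS.comap (X i)

/-- The tail σ-field `⋂ n, σ(X n, X (n + 1), …)` of the sequence `X`. -/
abbrev tailSigma {Ω S : Type*} [mS : MeasurableSpace S] (X : ℕ → Ω → S) : MeasurableSpace Ω :=
  ⨅ n : ℕ, ⨆ i : ℕ, ⨆ _ : n ≤ i, mS.comap (X i)

/-- `f` is a bounded real Borel function. -/
def IsBoundedBorel {S : Type*} [MeasurableSpace S] (f : S → ℝ) : Prop :=
  Measurable f ∧ ∃ C : ℝ, ∀ x, |f x| ≤ C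

/-- A sequence of real functions on `Ω` converges in probability (to some real random variable). -/
def ConvergesInProbability {Ω : Type*} [MeasurableSpace Ω] (P : Measure Ω)
    (Y : ℕ → Ω → ℝ) : Prop :=
  ∃ Z : Ω → ℝ, Measurable Z ∧ TendstoInMeasure P Y atTop Z

/-- `a n` is, for every `n`, a version of the conditional distribution of `X n` (the
`(n + 1)`-st variable of the sequence) given the first `n` variables. A random probability
measure on `S` is a Markov kernel from `Ω` to `S`. -/
structure IsPredictiveSequence {Ω S : Type*} [MeasurableSpace Ω] [MeasurableSpace S]
    (P : Measure Ω) (X : ℕ → Ω → S) (a : ℕ → Kernel Ω S) : Prop where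
  isMarkovKernel : ∀ n, IsMarkovKernel (a n)
  ae_eq_condProb : ∀ n (B : Set S), MeasurableSet B →
    (fun ω => (a n ω).real B) =ᵐ[P]
      P[(X n ⁻¹' B).indicator (fun _ => (1 : ℝ)) | pastSigma X n]

/-- Predictive distributions exist, for every sequence of random variables with values in a
standard Borel space. -/
theorem exists_isPredictiveSequence {Ω S : Type*} [MeasurableSpace Ω] [mS : MeasurableSpace S]
    [StandardBorelSpace S] (P : Measure Ω) [IsProbabilityMeasure P] (X : ℕ → Ω → S)
    (hX : ∀ n, Measurable (X n)) : ∃ a : ℕ → Kernel Ω S, IsPredictiveSequence P X a := by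
  obtain ⟨ω₀⟩ := nonempty_of_isProbabilityMeasure P
  have : Nonempty S := ⟨X 0 ω₀⟩
  have hpast : ∀ n, Measurable (fun ω (i : Fin n) => X i ω) := fun n =>
    measurable_pi_lambda _ fun i => hX i
  have hσ : ∀ n, MeasurableSpace.pi.comap (fun ω (i : Fin n) => X i ω) = pastSigma X n := by
    intro n
    simp only [MeasurableSpace.pi, MeasurableSpace.comap_iSup, MeasurableSpace.comap_comp,
      pastSigma]
    refine le_antisymm (iSup_le fun i => ?_) (iSup_le fun i => iSup_le fun hi => ?_)
    · exact le_iSup₂_of_le (i : ℕ) i.2 le_rfl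
    · exact le_iSup_of_le (⟨i, hi⟩ : Fin n) le_rfl
  refine ⟨fun n => (condDistrib (X n) (fun ω (i : Fin n) => X i ω) P).comap _ (hpast n),
    fun n => inferInstance, fun n B hB => ?_⟩
  have h := condDistrib_ae_eq_condExp (μ := P) (hpast n) (hX n) hB
  rw [hσ n] at h
  exact h

/-! Fix a measurable set B. The predictive probabilities of B converge in probability to some Z_B;
being bounded, they converge in L¹, and so do their Cesàro averages. The differences between the
indicators of B along the sequence and their predictive probabilities are bounded martingale
differences, so their sum over n terms has L² norm O(√n). Hence the empirical frequencies of B also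
converge to Z_B in L¹, and almost surely along a subsequence. Such a limit ignores any finite number
of variables, so Z_B has a tail measurable version.

It remains to glue the Z_B into a kernel. Positivity and finite additivity pass to the limit almost
surely. For continuity at ∅, let B_k decrease to ∅: then Z_{B_k} is almost surely nonnegative and
decreasing, so it suffices that E Z_{B_k} → 0. But B ↦ E Z_B is a setwise limit of the averaged
predictive laws, and Nikodym's theorem applies. An embedding of S into ℝ and rational distribution
functions then give a kernel α with α(B) = Z_B almost surely for each B. Uniform approximation by
simple functions passes from sets to bounded f. -/

open scoped Topology

/-! ### Setwise limits of finite measures -/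

/-- **Nikodym convergence theorem**: a setwise limit of finite measures is continuous at `∅`. -/
theorem tendsto_zero_of_tendsto_measureReal_of_antitone {S : Type*} [MeasurableSpace S]
    {μ : ℕ → Measure S} [∀ n, IsFiniteMeasure (μ n)] {q : Set S → ℝ}
    (hq : ∀ B, MeasurableSet B → Tendsto (fun n => (μ n).real B) atTop (𝓝 (q B)))
    {B : ℕ → Set S} (hB : ∀ k, MeasurableSet (B k)) (hanti : Antitone B) (hinter : ⋂ k, B k = ∅) :
    Tendsto (fun k => q (B k)) atTop (𝓝 0) := by
  have hqanti : Antitone fun k => q (B k) := fun i j hij =>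
    le_of_tendsto_of_tendsto' (hq _ (hB j)) (hq _ (hB i)) fun n => measureReal_mono (hanti hij)
  have hqpos : ∀ k, 0 ≤ q (B k) := fun k => ge_of_tendsto' (hq _ (hB k)) fun n => measureReal_nonneg
  have hbdd : BddBelow (Set.range fun k => q (B k)) := ⟨0, by rintro _ ⟨k, rfl⟩; exact hqpos k⟩
  have hlim := tendsto_atTop_ciInf hqanti hbdd
  set c := ⨅ k, q (B k)
  have hc0 : 0 ≤ c := le_ciInf hqpos
  rcases hc0.eq_or_lt with h0 | hpos
  · rwa [← h0] at hlim
  -- Gliding hump: if the limit c is positive, indices n_j and m_j are chosen alternately so that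
  -- `μ` at n_{j+1} puts almost all its mass in `B K` on the ring between `B` at m_j and at m_{j+1}.
  -- The union A of every second ring then has large and small mass alternately, so `q A` cannot be
  -- a limit.
  exfalso
  obtain ⟨K, hK⟩ := (hlim.eventually_lt_const (show c < c + c / 8 by linarith)).exists
  have hcle : ∀ k, c ≤ q (B k) := fun k => ciInf_le hbdd k
  have step : ∀ s : ℕ × ℕ, ∃ t : ℕ × ℕ, s.1 < t.1 ∧ s.2 < t.2 ∧ (K ≤ s.2 →
      c - c / 8 < (μ t.1).real (B s.2) ∧ (μ t.1).real (B K) < c + c / 8 ∧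
      (μ t.1).real (B t.2) < c / 8) := by
    rintro ⟨N, M⟩
    obtain ⟨n, hn1, hn2, hn3⟩ := (((hq _ (hB M)).eventually_const_lt
      (show c - c / 8 < q (B M) by linarith [hcle M])).and
      (((hq _ (hB K)).eventually_lt_const hK).and (eventually_gt_atTop N))).exists
    have hz : Tendsto (fun k => (μ n).real (B k)) atTop (𝓝 0) := by
      have := tendsto_measure_iInter_atTop (μ := μ n) (fun k => (hB k).nullMeasurableSet) hanti
        ⟨0, measure_ne_top _ _⟩
      rw [hinter, measure_empty] at this
      exact (ENNReal.tendsto_toReal ENNReal.zero_ne_top).comp this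
    obtain ⟨m, hm1, hm2⟩ := ((hz.eventually_lt_const (show (0 : ℝ) < c / 8 by linarith)).and
      (eventually_gt_atTop M)).exists
    exact ⟨(n, m), hn3, hm2, fun _ => ⟨hn1, hn2, hm1⟩⟩
  choose next h1 h2 h3 using step
  let s : ℕ → ℕ × ℕ := fun j => Nat.rec (0, K) (fun _ t => next t) j
  have hs : ∀ j, s (j + 1) = next (s j) := fun j => rfl
  have hN : StrictMono fun j => (s j).1 := strictMono_nat_of_lt_succ fun j => by
    rw [hs]; exact h1 _
  have hM : StrictMono fun j => (s j).2 := strictMono_nat_of_lt_succ fun j => by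
    rw [hs]; exact h2 _
  have hKs : ∀ j, K ≤ (s j).2 := fun j => hM.monotone (Nat.zero_le j)
  let A : Set S := ⋃ j, B (s (2 * j)).2 \ B (s (2 * j + 1)).2
  have hA : MeasurableSet A := MeasurableSet.iUnion fun j => (hB _).diff (hB _)
  -- At odd stages the charged ring is part of A.
  have hlow : c - c / 8 - c / 8 ≤ q A := by
    have hsub : Tendsto (fun j => (s (2 * j + 1)).1) atTop atTop :=
      (hN.comp (show StrictMono fun j => 2 * j + 1 from fun a b h => by dsimp; omega)).tendsto_atTop
    refine ge_of_tendsto' ((hq A hA).comp hsub) fun j => ?_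
    obtain ⟨e1, -, e3⟩ := h3 (s (2 * j)) (hKs (2 * j))
    rw [← hs] at e1 e3
    have hle : (μ (s (2 * j + 1)).1).real (B (s (2 * j)).2 \ B (s (2 * j + 1)).2) ≤
        (μ (s (2 * j + 1)).1).real A :=
      measureReal_mono (Set.subset_iUnion (fun j => B (s (2 * j)).2 \ B (s (2 * j + 1)).2) j)
    rw [measureReal_sdiff (hanti (hM.monotone (Nat.le_succ _))) (hB _)] at hle
    simp only [Function.comp]
    linarith
  -- At even stages the charged ring is disjoint from A. What remains has mass below (c + c/8) − (c
  -- − c/8) + c/8 = 3c/8, less than the lower bound 3c/4.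
  have hup : q A ≤ 3 * (c / 8) := by
    have hsub : Tendsto (fun j => (s (2 * j + 1 + 1)).1) atTop atTop :=
      (hN.comp (show StrictMono fun j => 2 * j + 1 + 1 from
        fun a b h => by dsimp; omega)).tendsto_atTop
    refine le_of_tendsto' ((hq A hA).comp hsub) fun j => ?_
    obtain ⟨e1, e2, e3⟩ := h3 (s (2 * j + 1)) (hKs (2 * j + 1))
    rw [← hs (2 * j + 1)] at e1 e2 e3
    have hAsub : A ⊆ (B K \ B (s (2 * j + 1)).2) ∪ B (s (2 * j + 1 + 1)).2 := by
      refine Set.iUnion_subset fun i x hx => ?_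
      rcases le_or_gt i j with hij | hij
      · exact Or.inl ⟨hanti (hKs _) hx.1,
          fun h => hx.2 (hanti (hM.monotone (show 2 * i + 1 ≤ 2 * j + 1 by omega)) h)⟩
      · exact Or.inr (hanti (hM.monotone (show 2 * j + 1 + 1 ≤ 2 * i by omega)) hx.1)
    have hle := (measureReal_mono (μ := μ (s (2 * j + 1 + 1)).1) hAsub).trans
      (measureReal_union_le _ _)
    rw [measureReal_sdiff (hanti (hKs (2 * j + 1))) (hB _)] at hle
    simp only [Function.comp]
    linarith
  linarith

/-! ### Convergence in probability and in L¹ for bounded sequences -/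

theorem ae_abs_le_of_tendstoInMeasure {Ω : Type*} {mΩ : MeasurableSpace Ω} {P : Measure Ω}
    {u : ℕ → Ω → ℝ} {z : Ω → ℝ} {C : ℝ} (hb : ∀ n, ∀ᵐ ω ∂P, |u n ω| ≤ C)
    (h : TendstoInMeasure P u atTop z) : ∀ᵐ ω ∂P, |z ω| ≤ C := by
  obtain ⟨ns, -, hns⟩ := h.exists_seq_tendsto_ae
  filter_upwards [hns, ae_all_iff.2 hb] with ω h1 h2
  exact le_of_tendsto' h1.abs fun n => h2 _

/-- Every subsequence has a further one converging almost surely, to which dominated convergence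
applies. -/
theorem tendsto_integral_abs_sub_of_tendstoInMeasure {Ω : Type*} {mΩ : MeasurableSpace Ω}
    {P : Measure Ω} [IsFiniteMeasure P] {u : ℕ → Ω → ℝ} {z : Ω → ℝ} {C : ℝ}
    (hu : ∀ n, AEStronglyMeasurable (u n) P) (hz : AEStronglyMeasurable z P)
    (hb : ∀ n, ∀ᵐ ω ∂P, |u n ω| ≤ C) (h : TendstoInMeasure P u atTop z) :
    Tendsto (fun n => ∫ ω, |u n ω - z ω| ∂P) atTop (𝓝 0) := by
  have hzb := ae_abs_le_of_tendstoInMeasure hb h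
  refine tendsto_of_subseq_tendsto fun ns hns => ?_
  obtain ⟨ms, -, hms⟩ := TendstoInMeasure.exists_seq_tendsto_ae (h.comp hns)
  refine ⟨ms, ?_⟩
  have := tendsto_integral_of_dominated_convergence (μ := P)
    (F := fun k ω => |u (ns (ms k)) ω - z ω|) (f := fun _ => 0) (fun _ => C + C)
    (fun k => ((hu _).sub hz).norm) (integrable_const _)
    (fun k => by
      filter_upwards [hb (ns (ms k)), hzb] with ω h1 h2
      rw [Real.norm_eq_abs, abs_abs]
      exact (abs_sub _ _).trans (add_le_add h1 h2))
    (by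
      filter_upwards [hms] with ω hω
      simpa using (hω.sub_const (z ω)).abs)
  simpa using this

theorem tendstoInMeasure_of_tendsto_integral_abs_sub {Ω : Type*} {mΩ : MeasurableSpace Ω}
    {P : Measure Ω} {u : ℕ → Ω → ℝ} {z : Ω → ℝ} (hu : ∀ n, Integrable (u n) P)
    (hz : Integrable z P) (h : Tendsto (fun n => ∫ ω, |u n ω - z ω| ∂P) atTop (𝓝 0)) :
    TendstoInMeasure P u atTop z := by
  refine tendstoInMeasure_of_tendsto_eLpNorm one_ne_zero (fun n => (hu n).1) hz.1 ?_
  have h' := ENNReal.tendsto_ofReal h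
  rw [ENNReal.ofReal_zero] at h'
  refine h'.congr fun n => ?_
  rw [eLpNorm_one_eq_lintegral_enorm]
  exact ofReal_integral_norm_eq_lintegral_enorm ((hu n).sub hz)

/-! ### Law of large numbers for martingale differences -/

/-- Sums of bounded martingale differences are bounded in `L²` by the square root of their number. -/
theorem integral_sq_sum_sub_condExp_le {Ω : Type*} {mΩ : MeasurableSpace Ω} {P : Measure Ω}
    [IsProbabilityMeasure P] {ℱ : ℕ → MeasurableSpace Ω} (hℱ : ∀ n, ℱ n ≤ mΩ) (hmono : Monotone ℱ)
    {Y : ℕ → Ω → ℝ} (hY : ∀ n, StronglyMeasurable[ℱ (n + 1)] (Y n)) (hb : ∀ n ω, |Y n ω| ≤ 1)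
    (n : ℕ) :
    StronglyMeasurable[ℱ n] (fun ω => ∑ i ∈ Finset.range n, (Y i ω - (P[Y i | ℱ i]) ω)) ∧
    (∀ᵐ ω ∂P, |∑ i ∈ Finset.range n, (Y i ω - (P[Y i | ℱ i]) ω)| ≤ 2 * n) ∧
    ∫ ω, (∑ i ∈ Finset.range n, (Y i ω - (P[Y i | ℱ i]) ω)) ^ 2 ∂P ≤ 4 * n := by
  have hYi : ∀ n, Integrable (Y n) P := fun n =>
    Integrable.of_bound ((hY n).mono (hℱ _)).aestronglyMeasurable 1 (ae_of_all _ (hb n))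
  have hgb : ∀ n, ∀ᵐ ω ∂P, |(P[Y n | ℱ n]) ω| ≤ 1 := fun n => by
    exact ae_bdd_abs_condExp_of_ae_bdd_abs (ae_of_all P (hb n))
  induction n with
  | zero => simpa using stronglyMeasurable_const
  | succ n ih =>
    obtain ⟨h1, h2, h3⟩ := ih
    set M : Ω → ℝ := fun ω => ∑ i ∈ Finset.range n, (Y i ω - (P[Y i | ℱ i]) ω) with hM
    set g := P[Y n | ℱ n] with hg
    have hgs : StronglyMeasurable[ℱ n] g := stronglyMeasurable_condExp
    simp only [Finset.sum_range_succ]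
    have hD : ∀ᵐ ω ∂P, |Y n ω - g ω| ≤ 2 := by
      filter_upwards [hgb n] with ω hω
      have := abs_sub (Y n ω) (g ω)
      have := hb n ω
      linarith
    refine ⟨(h1.mono (hmono n.le_succ)).add ((hY n).sub (hgs.mono (hmono n.le_succ))), ?_, ?_⟩
    · filter_upwards [h2, hD] with ω e1 e2
      have := abs_add_le (M ω) (Y n ω - g ω)
      push_cast
      linarith
    have hMm : AEStronglyMeasurable M P := (h1.mono (hℱ n)).aestronglyMeasurable
    have hYm : AEStronglyMeasurable (Y n) P := (hYi n).1
    have hgm : AEStronglyMeasurable g P := (hgs.mono (hℱ n)).aestronglyMeasurable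
    have bint : ∀ {F : Ω → ℝ}, AEStronglyMeasurable F P → ∀ C : ℝ, (∀ᵐ ω ∂P, |F ω| ≤ C) →
      Integrable F P := fun hF C h => Integrable.of_bound hF C h
    have iM2 : Integrable (fun ω => M ω ^ 2) P := bint (hMm.pow 2) ((2 * n) ^ 2) (by
      filter_upwards [h2] with ω hω
      rw [abs_pow]; gcongr)
    have iD2 : Integrable (fun ω => (Y n ω - g ω) ^ 2) P :=
      bint ((hYm.sub hgm).pow 2) (2 ^ 2) (by
        filter_upwards [hD] with ω hω
        rw [abs_pow]; gcongr)
    have iMY : Integrable (M * Y n) P := bint (hMm.mul hYm) (2 * n * 1) (by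
      filter_upwards [h2] with ω hω
      rw [Pi.mul_apply, abs_mul]
      exact mul_le_mul hω (hb n ω) (abs_nonneg _) (by positivity))
    have iMg : Integrable (M * g) P := bint (hMm.mul hgm) (2 * n * 1) (by
      filter_upwards [h2, hgb n] with ω hω hω'
      rw [Pi.mul_apply, abs_mul]
      exact mul_le_mul hω hω' (abs_nonneg _) (by positivity))
    -- Orthogonality: M is known at time n, so conditioning replaces Y n by g and the cross term of
    -- the square vanishes. Each new term adds at most 2² = 4.
    have hcross : ∫ ω, (M * Y n) ω ∂P = ∫ ω, (M * g) ω ∂P := by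
      rw [← integral_condExp (hℱ n) (f := M * Y n)]
      exact integral_congr_ae (condExp_mul_of_stronglyMeasurable_left h1 iMY (hYi n))
    have hexp : ∀ ω, (M ω + (Y n ω - g ω)) ^ 2 =
        M ω ^ 2 + (2 * ((M * Y n) ω - (M * g) ω) + (Y n ω - g ω) ^ 2) := fun ω => by
      simp only [Pi.mul_apply]; ring
    rw [integral_congr_ae (ae_of_all P hexp)]
    have i2 : Integrable (fun ω => 2 * ((M * Y n) ω - (M * g) ω)) P := (iMY.sub iMg).const_mul 2
    rw [integral_add iM2 (show Integrable (fun ω => 2 * ((M * Y n) ω - (M * g) ω) +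
        (Y n ω - g ω) ^ 2) P from i2.add iD2), integral_add i2 iD2, integral_const_mul, integral_sub iMY iMg,
      hcross, sub_self, mul_zero, zero_add]
    have hD2 : ∫ ω, (Y n ω - g ω) ^ 2 ∂P ≤ ∫ _ω, (4 : ℝ) ∂P :=
      integral_mono_ae iD2 (integrable_const _) (by
        filter_upwards [hD] with ω hω
        have := abs_le.1 hω
        nlinarith)
    simp only [integral_const, probReal_univ, one_smul] at hD2
    push_cast
    linarith

/-- A law of large numbers for bounded adapted sequences. -/
theorem tendsto_integral_abs_average_sub_condExp {Ω : Type*} {mΩ : MeasurableSpace Ω}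
    {P : Measure Ω} [IsProbabilityMeasure P] {ℱ : ℕ → MeasurableSpace Ω} (hℱ : ∀ n, ℱ n ≤ mΩ)
    (hmono : Monotone ℱ) {Y : ℕ → Ω → ℝ} (hY : ∀ n, StronglyMeasurable[ℱ (n + 1)] (Y n))
    (hb : ∀ n ω, |Y n ω| ≤ 1) :
    Tendsto (fun n : ℕ => (n : ℝ)⁻¹ *
      ∫ ω, |∑ i ∈ Finset.range n, (Y i ω - (P[Y i | ℱ i]) ω)| ∂P) atTop (𝓝 0) := by
  have hlim : Tendsto (fun n : ℕ => 5 / 2 * (√(n : ℝ))⁻¹) atTop (𝓝 0) := by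
    simpa using ((tendsto_inv_atTop_zero.comp
      (Real.tendsto_sqrt_atTop.comp tendsto_natCast_atTop_atTop)).const_mul (5 / 2 : ℝ))
  refine tendsto_of_tendsto_of_tendsto_of_le_of_le' tendsto_const_nhds hlim
    (Eventually.of_forall fun n => by positivity) ?_
  filter_upwards [eventually_gt_atTop 0] with n hn
  obtain ⟨h1, h2, h3⟩ := integral_sq_sum_sub_condExp_le hℱ hmono hY hb (P := P) n
  set M : Ω → ℝ := fun ω => ∑ i ∈ Finset.range n, (Y i ω - (P[Y i | ℱ i]) ω) with hM
  have hMm : AEStronglyMeasurable M P := (h1.mono (hℱ n)).aestronglyMeasurable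
  have iM : Integrable M P := Integrable.of_bound hMm _ h2
  have iM2 : Integrable (fun ω => M ω ^ 2) P :=
    Integrable.of_bound (hMm.pow 2) ((2 * n) ^ 2) (by
      filter_upwards [h2] with ω hω
      rw [Real.norm_eq_abs, abs_pow]; gcongr)
  have hn' : (0 : ℝ) < n := by exact_mod_cast hn
  set r := √(n : ℝ) with hr
  have hrpos : 0 < r := Real.sqrt_pos.2 hn'
  have hrr : (n : ℝ) = r * r := (Real.mul_self_sqrt hn'.le).symm
  -- Pointwise |M| ≤ M²/(2r) + r/2, used in place of Cauchy–Schwarz. With r = √n and ∫ M² ≤ 4r² this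
  -- integrates to 2r + r/2, whence the constant 5/2.
  have key : ∫ ω, |M ω| ∂P ≤ ∫ ω, ((2 * r)⁻¹ * M ω ^ 2 + r / 2) ∂P := by
    refine integral_mono iM.abs ((iM2.const_mul _).add (integrable_const _)) fun ω => ?_
    dsimp only
    rw [← sq_abs (M ω)]
    have := sq_nonneg (|M ω| - r)
    rw [show (2 * r)⁻¹ * |M ω| ^ 2 + r / 2 = (|M ω| ^ 2 + r ^ 2) / (2 * r) by field_simp,
      le_div_iff₀ (by positivity)]
    nlinarith
  rw [integral_add (iM2.const_mul _) (integrable_const _), integral_const_mul, integral_const,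
    probReal_univ, one_smul] at key
  have hkey : ∫ ω, |M ω| ∂P ≤ 5 / 2 * r := by
    refine key.trans ?_
    have : (2 * r)⁻¹ * ∫ ω, M ω ^ 2 ∂P ≤ (2 * r)⁻¹ * (4 * n) := by gcongr
    rw [hrr, show (2 * r)⁻¹ * (4 * (r * r)) = 2 * r by field_simp; norm_num] at this
    linarith
  calc (n : ℝ)⁻¹ * ∫ ω, |M ω| ∂P ≤ (n : ℝ)⁻¹ * (5 / 2 * r) := by gcongr
    _ = 5 / 2 * r⁻¹ := by rw [hrr]; field_simp

/-! ### Tail measurable versions of the limits -/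

theorem limUnder_congr_of_tendsto_sub {u v : ℕ → ℝ}
    (h : Tendsto (fun k => u k - v k) atTop (𝓝 0)) :
    limUnder atTop u = limUnder atTop v := by
  -- Both sequences have the same set of limits, and `limUnder` depends on nothing else. Its default
  -- value therefore agrees too where there is no limit, so the equality holds at every point and
  -- measurability with respect to the tail is exact, not merely up to null sets.
  have : (fun x => map u atTop ≤ 𝓝 x) = fun x => map v atTop ≤ 𝓝 x := by
    funext x
    refine propext ⟨fun hu => ?_, fun hv => ?_⟩
    · have h' := Tendsto.sub (show Tendsto u atTop (𝓝 x) from hu) h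
      simp only [sub_sub_cancel, sub_zero] at h'
      exact h'
    · have h' := Tendsto.add h (show Tendsto v atTop (𝓝 x) from hv)
      simp only [sub_add_cancel, zero_add] at h'
      exact h'
  simp only [limUnder, lim, this]

/-- Subsequential limits of averages are measurable with respect to the tail `σ`-field. -/
theorem measurable_tailSigma_limUnder_average {Ω S : Type*} [mS : MeasurableSpace S]
    {X : ℕ → Ω → S} {Y : ℕ → Ω → ℝ} (hY : ∀ i, Measurable[mS.comap (X i)] (Y i))
    {ns : ℕ → ℕ} (hns : Tendsto ns atTop atTop) :
    Measurable[tailSigma X] fun ω =>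
      limUnder atTop fun k => (ns k : ℝ)⁻¹ * ∑ i ∈ Finset.range (ns k), Y i ω := by
  intro s hs
  rw [MeasurableSpace.measurableSet_iInf]
  intro m
  revert s
  let mΩ : MeasurableSpace Ω := ⨆ i : ℕ, ⨆ _ : m ≤ i, mS.comap (X i)
  change Measurable _
  -- The first m terms, divided by `ns k`, vanish in the limit; the others are measurable for the
  -- field generated from time m on.
  have heq : (fun ω => limUnder atTop fun k => (ns k : ℝ)⁻¹ * ∑ i ∈ Finset.range (ns k), Y i ω) =
      fun ω => limUnder atTop fun k => (ns k : ℝ)⁻¹ * ∑ i ∈ Finset.Ico m (ns k), Y i ω := by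
    funext ω
    refine limUnder_congr_of_tendsto_sub ?_
    have h0 : Tendsto (fun k => (ns k : ℝ)⁻¹ * ∑ i ∈ Finset.range m, Y i ω) atTop (𝓝 0) := by
      simpa using (tendsto_inv_atTop_zero.comp
        (tendsto_natCast_atTop_atTop.comp hns)).mul_const (∑ i ∈ Finset.range m, Y i ω)
    refine h0.congr' ?_
    filter_upwards [hns.eventually_ge_atTop m] with k hk
    rw [Finset.sum_Ico_eq_sub _ hk]
    ring
  rw [heq]
  refine (StronglyMeasurable.limUnder fun k => Measurable.stronglyMeasurable ?_).measurable
  refine Measurable.const_mul (Finset.measurable_fun_sum _ fun i hi => ?_) _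
  exact (hY i).mono (le_iSup₂_of_le i (Finset.mem_Ico.1 hi).1 le_rfl) le_rfl

/-- If the one-step predictions of a bounded functional converge in probability, the limit has a
tail measurable version. -/
theorem exists_measurable_tailSigma_ae_eq {Ω S : Type*} {mΩ : MeasurableSpace Ω}
    [mS : MeasurableSpace S] {P : Measure Ω} [IsProbabilityMeasure P] {X : ℕ → Ω → S}
    (hX : ∀ n, Measurable (X n)) {Y : ℕ → Ω → ℝ} (hY : ∀ i, Measurable[mS.comap (X i)] (Y i))
    (hb : ∀ n ω, |Y n ω| ≤ 1) {Z : Ω → ℝ} (hZ : AEStronglyMeasurable Z P)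
    (h : TendstoInMeasure P (fun n => P[Y n | pastSigma X n]) atTop Z) :
    ∃ T : Ω → ℝ, Measurable[tailSigma X] T ∧ T =ᵐ[P] Z := by
  have hℱ : ∀ n, pastSigma X n ≤ mΩ := fun n => iSup₂_le fun i _ => (hX i).comap_le
  have hmono : Monotone (pastSigma X) := fun m n hmn =>
    iSup₂_le fun i hi => le_iSup₂_of_le i (hi.trans_le hmn) le_rfl
  have hYs : ∀ n, StronglyMeasurable[pastSigma X (n + 1)] (Y n) := fun n =>
    ((hY n).mono (le_iSup₂_of_le n n.lt_succ_self le_rfl) le_rfl).stronglyMeasurable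
  have hYi : ∀ n, Integrable (Y n) P := fun n =>
    Integrable.of_bound ((hYs n).mono (hℱ _)).aestronglyMeasurable 1 (ae_of_all _ (hb n))
  set g : ℕ → Ω → ℝ := fun n => P[Y n | pastSigma X n] with hg
  have hgi : ∀ n, Integrable (g n) P := fun n => integrable_condExp
  have hgb : ∀ n, ∀ᵐ ω ∂P, |g n ω| ≤ 1 := fun n =>
    ae_bdd_abs_condExp_of_ae_bdd_abs (ae_of_all P (hb n))
  have hZb := ae_abs_le_of_tendstoInMeasure hgb h
  have hZi : Integrable Z P := Integrable.of_bound hZ 1 hZb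
  have hL1 := tendsto_integral_abs_sub_of_tendstoInMeasure (fun n => (hgi n).1) hZ hgb h
  have hlln := tendsto_integral_abs_average_sub_condExp hℱ hmono hYs hb (P := P)
  have hAi : ∀ n : ℕ, Integrable (fun ω => (n : ℝ)⁻¹ * ∑ i ∈ Finset.range n, Y i ω) P := fun n =>
    (integrable_finsetSum _ fun i _ => hYi i).const_mul _
  have hA : Tendsto (fun n : ℕ => ∫ ω, |(n : ℝ)⁻¹ * ∑ i ∈ Finset.range n, Y i ω - Z ω| ∂P)
      atTop (𝓝 0) := by
    have hsum := hlln.add hL1.cesaro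
    rw [add_zero] at hsum
    refine tendsto_of_tendsto_of_tendsto_of_le_of_le' tendsto_const_nhds hsum
      (Eventually.of_forall fun n => by positivity) ?_
    filter_upwards [eventually_gt_atTop 0] with n hn
    have hn' : (n : ℝ) ≠ 0 := by exact_mod_cast hn.ne'
    have i1 : Integrable (fun ω => |∑ i ∈ Finset.range n, (Y i ω - g i ω)|) P :=
      (integrable_finsetSum _ fun i _ => (hYi i).sub (hgi i)).abs
    have i2 : ∀ i, Integrable (fun ω => |g i ω - Z ω|) P := fun i => ((hgi i).sub hZi).abs
    have i3 : Integrable (fun ω => ∑ i ∈ Finset.range n, |g i ω - Z ω|) P :=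
      integrable_finsetSum _ fun i _ => i2 i
    rw [← integral_finsetSum _ fun i _ => i2 i, ← mul_add, ← integral_add i1 i3,
      ← integral_const_mul]
    refine integral_mono ((hAi n).sub hZi).abs ((i1.add i3).const_mul _) fun ω => ?_
    -- Martingale part plus Cesàro average of the errors of prediction; the identity needs n ≠ 0.
    have e : (n : ℝ)⁻¹ * ∑ i ∈ Finset.range n, Y i ω - Z ω =
        (n : ℝ)⁻¹ * (∑ i ∈ Finset.range n, (Y i ω - g i ω) +
          ∑ i ∈ Finset.range n, (g i ω - Z ω)) := by
      rw [← Finset.sum_add_distrib]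
      simp only [sub_add_sub_cancel, Finset.sum_sub_distrib, Finset.sum_const, Finset.card_range,
        nsmul_eq_mul]
      field_simp
    dsimp only
    rw [e, abs_mul, abs_of_nonneg (show (0 : ℝ) ≤ (n : ℝ)⁻¹ by positivity)]
    gcongr
    exact (abs_add_le _ _).trans (add_le_add le_rfl (Finset.abs_sum_le_sum_abs _ _))
  obtain ⟨ns, hns, hlim⟩ :=
    (tendstoInMeasure_of_tendsto_integral_abs_sub hAi hZi hA).exists_seq_tendsto_ae
  refine ⟨_, measurable_tailSigma_limUnder_average hY hns.tendsto_atTop, ?_⟩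
  filter_upwards [hlim] with ω hω
  exact hω.limUnder_eq

/-! ### From almost surely additive families to kernels -/

/-- A Markov kernel with given rational distribution functions, up to a negligible set. -/
theorem exists_kernel_real_of_eventually_isRatStieltjesPoint {Ω : Type*} [MeasurableSpace Ω]
    {l : Filter Ω} {F : Ω → ℚ → ℝ} (hF : Measurable F)
    (hpt : ∀ᶠ ω in l, IsRatStieltjesPoint F ω) (hnn : ∀ᶠ ω in l, ∀ q, 0 ≤ F ω q) :
    ∃ κ : Kernel Ω ℝ, IsMarkovKernel κ ∧ ∀ q : ℚ, ∀ᶠ ω in l, (κ ω).real (Set.Iic (q : ℝ)) = F ω q := by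
  -- Where F ω is not a rational distribution function, `stieltjesOfMeasurableRat` substitutes a
  -- default one, so every fibre is a probability measure.
  refine ⟨⟨fun ω => (stieltjesOfMeasurableRat F hF ω).measure,
    measurable_measure_stieltjesOfMeasurableRat hF⟩, ⟨fun ω => ?_⟩, fun q => ?_⟩
  · exact instIsProbabilityMeasure_stieltjesOfMeasurableRat hF ω
  · filter_upwards [hpt, hnn] with ω h1 h2
    change ((stieltjesOfMeasurableRat F hF ω).measure).real (Set.Iic (q : ℝ)) = F ω q
    rw [Measure.real, measure_stieltjesOfMeasurableRat_Iic, stieltjesOfMeasurableRat_eq,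
      toRatCDF_of_isRatStieltjesPoint h1, ENNReal.toReal_ofReal (h2 q)]

/-- A family of functions indexed by measurable sets which is, up to negligible sets, a finitely
additive probability that is continuous at `∅`. -/
structure IsRandomProbability {Ω S : Type*} [MeasurableSpace S] (l : Filter Ω)
    (Z : Set S → Ω → ℝ) : Prop where
  univ : ∀ᶠ ω in l, Z Set.univ ω = 1
  nonneg : ∀ B, MeasurableSet B → ∀ᶠ ω in l, 0 ≤ Z B ω
  union : ∀ B C, MeasurableSet B → MeasurableSet C → Disjoint B C →
    ∀ᶠ ω in l, Z (B ∪ C) ω = Z B ω + Z C ω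
  tendsto_zero : ∀ B : ℕ → Set S, (∀ k, MeasurableSet (B k)) → Antitone B → ⋂ k, B k = ∅ →
    ∀ᶠ ω in l, Tendsto (fun k => Z (B k) ω) atTop (𝓝 0)

namespace IsRandomProbability

variable {Ω S : Type*} [MeasurableSpace S] {l : Filter Ω} {Z : Set S → Ω → ℝ}

theorem diff (hZ : IsRandomProbability l Z) {B C : Set S} (hB : MeasurableSet B)
    (hC : MeasurableSet C) (h : C ⊆ B) : ∀ᶠ ω in l, Z (B \ C) ω = Z B ω - Z C ω := by
  filter_upwards [hZ.union C (B \ C) hC (hB.diff hC) disjoint_sdiff_self_right] with ω hω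
  rw [Set.union_sdiff_cancel h] at hω
  linarith

theorem empty (hZ : IsRandomProbability l Z) : ∀ᶠ ω in l, Z ∅ ω = 0 := by
  filter_upwards [hZ.diff .empty .empty subset_rfl] with ω hω
  simpa using hω

theorem mono (hZ : IsRandomProbability l Z) {B C : Set S} (hB : MeasurableSet B)
    (hC : MeasurableSet C) (h : C ⊆ B) : ∀ᶠ ω in l, Z C ω ≤ Z B ω := by
  filter_upwards [hZ.diff hB hC h, hZ.nonneg _ (hB.diff hC)] with ω h1 h2
  linarith

theorem tendsto_iInter (hZ : IsRandomProbability l Z) {B : ℕ → Set S}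
    (hB : ∀ k, MeasurableSet (B k)) (hanti : Antitone B) [CountableInterFilter l] :
    ∀ᶠ ω in l, Tendsto (fun k => Z (B k) ω) atTop (𝓝 (Z (⋂ k, B k) ω)) := by
  have hI : MeasurableSet (⋂ k, B k) := .iInter hB
  filter_upwards [hZ.tendsto_zero (fun k => B k \ ⋂ k, B k) (fun k => (hB k).diff hI)
    (fun i j hij => Set.sdiff_subset_sdiff_left (hanti hij))
    (Set.eq_empty_of_forall_notMem fun x hx => (Set.mem_iInter.1 hx 0).2
      (Set.mem_iInter.2 fun k => (Set.mem_iInter.1 hx k).1)),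
    eventually_countable_forall.2 fun k => hZ.diff (hB k) hI (Set.iInter_subset _ k)] with ω h1 h2
  simp only [h2] at h1
  simpa using h1.add_const (Z (⋂ k, B k) ω)

theorem tendsto_iUnion (hZ : IsRandomProbability l Z) {B : ℕ → Set S}
    (hB : ∀ k, MeasurableSet (B k)) (hmono : Monotone B) [CountableInterFilter l] :
    ∀ᶠ ω in l, Tendsto (fun k => Z (B k) ω) atTop (𝓝 (Z (⋃ k, B k) ω)) := by
  have hI : MeasurableSet (⋃ k, B k) := .iUnion hB
  filter_upwards [hZ.tendsto_zero (fun k => (⋃ k, B k) \ B k) (fun k => hI.diff (hB k))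
    (fun i j hij => Set.sdiff_subset_sdiff_right (hmono hij))
    (by rw [← Set.sdiff_iUnion, Set.sdiff_self]),
    eventually_countable_forall.2 fun k => hZ.diff hI (hB k) (Set.subset_iUnion _ k)] with ω h1 h2
  simp only [h2] at h1
  simpa using h1.const_sub (Z (⋃ k, B k) ω)

theorem hasSum (hZ : IsRandomProbability l Z) {f : ℕ → Set S} (hf : ∀ k, MeasurableSet (f k))
    (hd : Pairwise (Function.onFun Disjoint f)) [CountableInterFilter l] :
    ∀ᶠ ω in l, HasSum (fun k => Z (f k) ω) (Z (⋃ k, f k) ω) := by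
  have hac : ∀ n, MeasurableSet (⋃ i ∈ Finset.range n, f i) := fun n =>
    Finset.measurableSet_biUnion _ fun i _ => hf i
  have hstep : ∀ n, ∀ᶠ ω in l, Z (⋃ i ∈ Finset.range (n + 1), f i) ω =
      Z (f n) ω + Z (⋃ i ∈ Finset.range n, f i) ω := fun n => by
    rw [Finset.range_add_one, Finset.set_biUnion_insert]
    refine hZ.union _ _ (hf n) (hac n) ?_
    rw [Set.disjoint_iUnion₂_right]
    exact fun i hi => hd (Finset.mem_range.1 hi).ne'
  have hlim := hZ.tendsto_iUnion hac fun m n hmn =>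
    Set.biUnion_subset_biUnion_left (by simpa using hmn)
  have hU : ⋃ n, ⋃ i ∈ Finset.range n, f i = ⋃ k, f k := by
    ext x
    simp only [Set.mem_iUnion, Finset.mem_range]
    exact ⟨fun ⟨_, i, _, hx⟩ => ⟨i, hx⟩, fun ⟨i, hx⟩ => ⟨i + 1, i, i.lt_succ_self, hx⟩⟩
  rw [hU] at hlim
  filter_upwards [hlim, eventually_countable_forall.2 hstep, hZ.empty,
    eventually_countable_forall.2 fun k => hZ.nonneg _ (hf k)] with ω h1 h2 h3 h4
  rw [hasSum_iff_tendsto_nat_of_nonneg h4]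
  refine h1.congr fun n => ?_
  induction n with
  | zero => simpa using h3
  | succ n ih => rw [h2, ih, Finset.sum_range_succ, add_comm]

/-- Limits at ±∞ and right continuity are each tested along one sequence of half-lines, so only
countably many exceptional sets arise; monotonicity over ℚ then extends them to all rationals. -/
theorem isRatStieltjesPoint (hZ : IsRandomProbability l Z) [CountableInterFilter l] {e : S → ℝ}
    (he : Measurable e) :
    ∀ᶠ ω in l, IsRatStieltjesPoint (fun ω (q : ℚ) => Z (e ⁻¹' Set.Iic (q : ℝ)) ω) ω := by
  have hm : ∀ q : ℚ, MeasurableSet (e ⁻¹' Set.Iic (q : ℝ)) := fun q => he measurableSet_Iic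
  have hsub : ∀ {q r : ℚ}, q ≤ r → e ⁻¹' Set.Iic (q : ℝ) ⊆ e ⁻¹' Set.Iic (r : ℝ) := fun h =>
    Set.preimage_mono (Set.Iic_subset_Iic.2 (by exact_mod_cast h))
  have hmono : ∀ᶠ ω in l, ∀ q r : ℚ, q ≤ r →
      Z (e ⁻¹' Set.Iic (q : ℝ)) ω ≤ Z (e ⁻¹' Set.Iic (r : ℝ)) ω :=
    eventually_countable_forall.2 fun q => eventually_countable_forall.2 fun r => by
      by_cases h : q ≤ r
      · filter_upwards [hZ.mono (hm r) (hm q) (hsub h)] with ω hω _ using hω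
      · exact Eventually.of_forall fun ω h' => absurd h' h
  have htop := hZ.tendsto_iUnion (B := fun n : ℕ => e ⁻¹' Set.Iic ((n : ℚ) : ℝ)) (fun n => hm n)
    fun m n hmn => hsub (by exact_mod_cast hmn)
  have hbot := hZ.tendsto_iInter (B := fun n : ℕ => e ⁻¹' Set.Iic ((-n : ℚ) : ℝ)) (fun n => hm (-n))
    fun m n hmn => hsub (neg_le_neg (by exact_mod_cast hmn))
  have hright : ∀ᶠ ω in l, ∀ t : ℚ, Tendsto
      (fun n : ℕ => Z (e ⁻¹' Set.Iic ((t + 1 / ((n : ℚ) + 1) : ℚ) : ℝ)) ω) atTop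
      (𝓝 (Z (e ⁻¹' Set.Iic (t : ℝ)) ω)) := by
    refine eventually_countable_forall.2 fun t => ?_
    have := hZ.tendsto_iInter (B := fun n : ℕ => e ⁻¹' Set.Iic ((t + 1 / ((n : ℚ) + 1) : ℚ) : ℝ))
      (fun n => hm _) fun m n hmn => hsub (by gcongr)
    convert this using 6
    ext x
    simp only [Set.mem_preimage, Set.mem_Iic, Set.mem_iInter]
    refine ⟨fun h n => h.trans ?_, fun h => ?_⟩
    · have : (0 : ℚ) ≤ 1 / ((n : ℚ) + 1) := by positivity
      exact_mod_cast le_add_of_nonneg_right this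
    · have hl := (tendsto_one_div_add_atTop_nhds_zero_nat (𝕜 := ℝ)).const_add (t : ℝ)
      rw [add_zero] at hl
      exact ge_of_tendsto' hl fun n => by simpa using h n
  have hUtop : ⋃ n : ℕ, e ⁻¹' Set.Iic ((n : ℚ) : ℝ) = Set.univ := by
    refine Set.eq_univ_of_forall fun x => Set.mem_iUnion.2 ?_
    obtain ⟨n, hn⟩ := exists_nat_ge (e x)
    exact ⟨n, by simpa using hn⟩
  have hIbot : ⋂ n : ℕ, e ⁻¹' Set.Iic ((-n : ℚ) : ℝ) = ∅ := by
    refine Set.eq_empty_of_forall_notMem fun x hx => ?_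
    obtain ⟨n, hn⟩ := exists_nat_gt (-e x)
    have := Set.mem_iInter.1 hx n
    simp only [Set.mem_preimage, Set.mem_Iic, Rat.cast_neg, Rat.cast_natCast] at this
    linarith
  rw [hUtop] at htop
  rw [hIbot] at hbot
  filter_upwards [hmono, htop, hbot, hright, hZ.univ, hZ.empty,
    eventually_countable_forall.2 fun q => hZ.nonneg _ (hm q)] with ω h1 h2 h3 h4 h5 h6 h7
  rw [h5] at h2
  rw [h6] at h3
  have hM : Monotone fun q : ℚ => Z (e ⁻¹' Set.Iic (q : ℝ)) ω := fun q r => h1 q r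
  refine ⟨hM, ?_, ?_, fun t => le_antisymm ?_ ?_⟩
  · exact (tendsto_iff_tendsto_subseq_of_monotone hM tendsto_natCast_atTop_atTop).2 h2
  · refine tendsto_order.2 ⟨fun a ha => Eventually.of_forall fun q => ha.trans_le (h7 q),
      fun a ha => ?_⟩
    obtain ⟨n, hn⟩ := (h3.eventually_lt_const ha).exists
    filter_upwards [eventually_le_atBot (-n : ℚ)] with q hq using (hM hq).trans_lt hn
  · refine ge_of_tendsto' (h4 t) fun n => ?_
    exact ciInf_le (f := fun r : Set.Ioi t => Z (e ⁻¹' Set.Iic ((r : ℚ) : ℝ)) ω)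
      ⟨0, by rintro _ ⟨r, rfl⟩; exact h7 _⟩
      ⟨t + 1 / ((n : ℚ) + 1), lt_add_of_pos_right t (by positivity)⟩
  · exact le_ciInf fun r => h1 _ _ r.2.le

/-- A π-λ argument from rational half-lines, each step discarding countably many exceptional sets.
These enter only through `l`, so the σ-field on Ω may be smaller than the one that carries the
probability; this is what allows a tail measurable kernel. -/
theorem exists_kernel_real [MeasurableSpace Ω] (hZ : IsRandomProbability l Z)
    [CountableInterFilter l] (hmeas : ∀ B, MeasurableSet B → Measurable (Z B)) {e : S → ℝ}
    (he : Measurable e) : ∃ κ : Kernel Ω ℝ, IsMarkovKernel κ ∧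
      ∀ B, MeasurableSet B → ∀ᶠ ω in l, (κ ω).real B = Z (e ⁻¹' B) ω := by
  obtain ⟨κ, hκ, hIic⟩ := exists_kernel_real_of_eventually_isRatStieltjesPoint
    (measurable_pi_lambda (fun ω (q : ℚ) => Z (e ⁻¹' Set.Iic (q : ℝ)) ω) fun q =>
      hmeas _ (he measurableSet_Iic)) (hZ.isRatStieltjesPoint he)
    (eventually_countable_forall.2 fun q => hZ.nonneg _ (he measurableSet_Iic))
  refine ⟨κ, hκ, fun B hB => ?_⟩
  refine MeasurableSpace.induction_on_inter
    (C := fun B _ => ∀ᶠ ω in l, (κ ω).real B = Z (e ⁻¹' B) ω)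
    (BorelSpace.measurable_eq.trans Real.borel_eq_generateFrom_Iic_rat)
    Real.isPiSystem_Iic_rat ?_ ?_ ?_ ?_ B hB
  · filter_upwards [hZ.empty] with ω hω
    simp [hω]
  · intro t ht
    obtain ⟨q, rfl⟩ := Set.mem_iUnion.1 ht
    exact hIic q
  · intro t ht ih
    filter_upwards [ih, hZ.univ, hZ.diff .univ (he ht) (Set.subset_univ _)] with ω h1 h2 h3
    rw [probReal_compl_eq_one_sub ht, h1, Set.preimage_compl, Set.compl_eq_univ_sdiff, h3, h2]
  · intro f hd hf ih
    filter_upwards [eventually_countable_forall.2 ih, hZ.hasSum (fun k => he (hf k))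
      fun i j hij => (hd hij).preimage e] with ω h1 h2
    simp only [← h1] at h2
    rw [Set.preimage_iUnion]
    refine HasSum.unique ?_ h2
    have hne : ∑' i, κ ω (f i) ≠ ⊤ := by
      rw [← measure_iUnion hd hf]; exact measure_ne_top (κ ω) _
    rw [Measure.real, measure_iUnion hd hf,
      ENNReal.tsum_toReal_eq fun i => measure_ne_top (κ ω) (f i)]
    exact ENNReal.hasSum_toReal hne

/-- Such a family is given by a Markov kernel if the target is a standard Borel space. -/
theorem exists_kernel [MeasurableSpace Ω] [StandardBorelSpace S] [Nonempty S]
    (hZ : IsRandomProbability l Z) [CountableInterFilter l]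
    (hmeas : ∀ B, MeasurableSet B → Measurable (Z B)) : ∃ κ : Kernel Ω S, IsMarkovKernel κ ∧
      ∀ B, MeasurableSet B → ∀ᶠ ω in l, (κ ω).real B = Z B ω := by
  have he := measurableEmbedding_embeddingReal S
  obtain ⟨κ, hκ, h⟩ := hZ.exists_kernel_real hmeas he.measurable
  refine ⟨Kernel.borelMarkovFromReal S κ, inferInstance, fun B hB => ?_⟩
  filter_upwards [h _ (he.measurableSet_image' hB), h _ he.measurableSet_range.compl, hZ.empty]
    with ω h1 h2 h3
  -- The complement of the range of the embedding pulls back to ∅, so it is `κ ω`-null and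
  -- `borelMarkovFromReal` is off its default branch.
  rw [Set.preimage_compl, Set.preimage_range, Set.compl_univ, h3, measureReal_eq_zero_iff] at h2
  rw [Measure.real, Kernel.borelMarkovFromReal_apply' _ _ _ hB, if_pos h2]
  rw [he.injective.preimage_image] at h1
  exact h1

end IsRandomProbability

/-! ### From sets to bounded functions -/

theorem exists_simpleFunc_abs_sub_le {S : Type*} [MeasurableSpace S] {f : S → ℝ}
    (hf : IsBoundedBorel f) {ε : ℝ} (hε : 0 < ε) :
    ∃ g : SimpleFunc S ℝ, ∀ x, |f x - g x| ≤ ε := by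
  obtain ⟨hfm, C, hC⟩ := hf
  -- Rounding f down to a multiple of ε; boundedness leaves finitely many values.
  have hm : Measurable fun x => ⌊f x / ε⌋ := (hfm.div_const ε).floor
  have hfin : (Set.range fun x => ⌊f x / ε⌋).Finite := by
    refine (Set.finite_Icc ⌊-C / ε⌋ ⌊C / ε⌋).subset ?_
    rintro _ ⟨x, rfl⟩
    have := abs_le.1 (hC x)
    exact ⟨Int.floor_mono (by gcongr; exact this.1), Int.floor_mono (by gcongr; exact this.2)⟩
  let g : SimpleFunc S ℤ := ⟨fun x => ⌊f x / ε⌋, fun y => hm (measurableSet_singleton y), hfin⟩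
  refine ⟨g.map fun k : ℤ => ε * (k : ℝ), fun x => ?_⟩
  change |f x - ε * (⌊f x / ε⌋ : ℝ)| ≤ ε
  have e : f x - ε * (⌊f x / ε⌋ : ℝ) = ε * (f x / ε - ⌊f x / ε⌋) := by field_simp
  rw [e, abs_mul, abs_of_pos hε, abs_of_nonneg (sub_nonneg.2 (Int.floor_le _))]
  have := (Int.sub_one_lt_floor (f x / ε)).le
  exact mul_le_of_le_one_right hε.le (by linarith)

theorem IsBoundedBorel.integrable {S : Type*} [MeasurableSpace S] {f : S → ℝ}
    (hf : IsBoundedBorel f) (μ : Measure S) [IsFiniteMeasure μ] : Integrable f μ := by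
  obtain ⟨hfm, C, hC⟩ := hf
  exact Integrable.of_bound hfm.aestronglyMeasurable C (ae_of_all _ hC)

theorem IsBoundedBorel.integrable_integral_kernel {Ω S : Type*} [MeasurableSpace Ω]
    [MeasurableSpace S] {f : S → ℝ} (hf : IsBoundedBorel f) (κ : Kernel Ω S) [IsMarkovKernel κ]
    (P : Measure Ω) [IsFiniteMeasure P] : Integrable (fun ω => ∫ x, f x ∂(κ ω)) P := by
  obtain ⟨hfm, C, hC⟩ := hf
  refine Integrable.of_bound hfm.stronglyMeasurable.integral_kernel.aestronglyMeasurable C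
    (ae_of_all _ fun ω => ?_)
  simpa using norm_integral_le_of_norm_le_const (f := f) (μ := κ ω) (ae_of_all _ hC)

theorem integrable_kernel_real {Ω S : Type*} [MeasurableSpace Ω] [MeasurableSpace S]
    (κ : Kernel Ω S) [IsMarkovKernel κ] (P : Measure Ω) [IsFiniteMeasure P] {B : Set S}
    (hB : MeasurableSet B) : Integrable (fun ω => (κ ω).real B) P :=
  Integrable.of_bound (Kernel.measurable_coe κ hB).ennreal_toReal.aestronglyMeasurable 1
    (ae_of_all _ fun ω => by
      rw [Real.norm_of_nonneg measureReal_nonneg]; exact measureReal_le_one)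

/-- Convergence in `L¹` of random probabilities on sets implies convergence of integrals. -/
theorem tendsto_integral_abs_sub_integral_kernel {Ω S : Type*} [MeasurableSpace Ω]
    [MeasurableSpace S] {P : Measure Ω} [IsProbabilityMeasure P] {a : ℕ → Kernel Ω S}
    [∀ n, IsMarkovKernel (a n)] {α : Kernel Ω S} [IsMarkovKernel α]
    (h : ∀ B, MeasurableSet B →
      Tendsto (fun n => ∫ ω, |(a n ω).real B - (α ω).real B| ∂P) atTop (𝓝 0))
    {f : S → ℝ} (hf : IsBoundedBorel f) :
    Tendsto (fun n => ∫ ω, |∫ x, f x ∂(a n ω) - ∫ x, f x ∂(α ω)| ∂P) atTop (𝓝 0) := by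
  refine tendsto_order.2 ⟨fun c hc => Eventually.of_forall fun n =>
    hc.trans_le (integral_nonneg fun ω => abs_nonneg _), fun c hc => ?_⟩
  -- Replacing f by g costs c/4 for each of the two kernels, and for g only finitely many sets
  -- matter.
  obtain ⟨g, hg⟩ := exists_simpleFunc_abs_sub_le hf (show 0 < c / 4 by linarith)
  have hsum : Tendsto (fun n => c / 4 + c / 4 + ∑ y ∈ g.range, |y| *
      ∫ ω, |(a n ω).real (g ⁻¹' {y}) - (α ω).real (g ⁻¹' {y})| ∂P) atTop
      (𝓝 (c / 4 + c / 4 + ∑ y ∈ g.range, |y| * 0)) :=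
    (tendsto_finsetSum _ fun y _ => (h _ (g.measurableSet_fiber y)).const_mul _).const_add _
  simp only [mul_zero, Finset.sum_const_zero, add_zero] at hsum
  filter_upwards [hsum.eventually_lt_const (show c / 4 + c / 4 < c by linarith)] with n hn
  refine lt_of_le_of_lt ?_ hn
  have i1 : ∀ y, Integrable
      (fun ω => |(a n ω).real (g ⁻¹' {y}) - (α ω).real (g ⁻¹' {y})|) P := fun y =>
    ((integrable_kernel_real (a n) P (g.measurableSet_fiber y)).sub
      (integrable_kernel_real α P (g.measurableSet_fiber y))).abs
  have i2 : Integrable (fun ω => ∑ y ∈ g.range, |y| *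
      |(a n ω).real (g ⁻¹' {y}) - (α ω).real (g ⁻¹' {y})|) P :=
    integrable_finsetSum _ fun y _ => (i1 y).const_mul _
  simp only [← integral_const_mul]
  rw [← integral_finsetSum _ fun y _ => (i1 y).const_mul _]
  have hconst : c / 4 + c / 4 = ∫ _ω, (c / 4 + c / 4) ∂P := by simp
  rw [hconst, ← integral_add (integrable_const _) i2]
  refine integral_mono ((hf.integrable_integral_kernel (a n) P).sub
    (hf.integrable_integral_kernel α P)).abs ((integrable_const _).add i2) fun ω => ?_
  have hgi : ∀ μ : Measure S, IsProbabilityMeasure μ → Integrable g μ := fun μ _ =>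
    g.integrable_of_isFiniteMeasure
  have happrox : ∀ μ : Measure S, IsProbabilityMeasure μ →
      |∫ x, f x ∂μ - ∫ x, g x ∂μ| ≤ c / 4 := fun μ hμ => by
    rw [← integral_sub (hf.integrable μ) (hgi μ hμ)]
    simpa using norm_integral_le_of_norm_le_const (f := fun x => f x - g x) (μ := μ)
      (ae_of_all _ hg)
  have hgint : ∀ μ : Measure S, IsProbabilityMeasure μ →
      ∫ x, g x ∂μ = ∑ y ∈ g.range, μ.real (g ⁻¹' {y}) * y := fun μ hμ => by
    rw [← SimpleFunc.integral_eq_integral g (hgi μ hμ), SimpleFunc.integral_eq]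
    rfl
  have e1 := happrox (a n ω) inferInstance
  have e2 := happrox (α ω) inferInstance
  have e3 : |∫ x, g x ∂(a n ω) - ∫ x, g x ∂(α ω)| ≤ ∑ y ∈ g.range, |y| *
      |(a n ω).real (g ⁻¹' {y}) - (α ω).real (g ⁻¹' {y})| := by
    rw [hgint _ inferInstance, hgint _ inferInstance, ← Finset.sum_sub_distrib]
    refine (Finset.abs_sum_le_sum_abs _ _).trans (Finset.sum_le_sum fun y _ => ?_)
    rw [← sub_mul, abs_mul, mul_comm]
  have e4 := abs_sub_le (∫ x, f x ∂(a n ω)) (∫ x, g x ∂(a n ω)) (∫ x, f x ∂(α ω))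
  have e5 := abs_sub_le (∫ x, g x ∂(a n ω)) (∫ x, g x ∂(α ω)) (∫ x, f x ∂(α ω))
  rw [abs_sub_comm (∫ x, g x ∂(α ω))] at e5
  dsimp only [Pi.add_apply]
  linarith

/-! ### Setwise limits of predictive distributions and the conclusion -/

theorem exists_seq_tendsto_ae_of_tendstoInMeasure_pair {Ω : Type*} [MeasurableSpace Ω]
    {P : Measure Ω} {u v : ℕ → Ω → ℝ} {z w : Ω → ℝ} (hu : TendstoInMeasure P u atTop z)
    (hv : TendstoInMeasure P v atTop w) : ∃ ns : ℕ → ℕ, Tendsto ns atTop atTop ∧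
      ∀ᵐ ω ∂P, Tendsto (fun i => u (ns i) ω) atTop (𝓝 (z ω)) ∧
        Tendsto (fun i => v (ns i) ω) atTop (𝓝 (w ω)) := by
  obtain ⟨ns, h1, h1'⟩ := hu.exists_seq_tendsto_ae'
  obtain ⟨ms, h2, h2'⟩ := (hv.comp h1).exists_seq_tendsto_ae'
  refine ⟨ns ∘ ms, h1.comp h2, ?_⟩
  filter_upwards [h1', h2'] with ω e1 e2
  exact ⟨e1.comp h2, e2⟩

/-- The limits in probability of random probability measures, evaluated at sets, form a random
probability. -/
theorem isRandomProbability_of_tendstoInMeasure {Ω S : Type*} [MeasurableSpace Ω]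
    [MeasurableSpace S] {P : Measure Ω} [IsProbabilityMeasure P] {a : ℕ → Kernel Ω S}
    [∀ n, IsMarkovKernel (a n)] {Z : Set S → Ω → ℝ}
    (hZm : ∀ B, MeasurableSet B → AEStronglyMeasurable (Z B) P)
    (h : ∀ B, MeasurableSet B → TendstoInMeasure P (fun n ω => (a n ω).real B) atTop (Z B)) :
    IsRandomProbability (ae P) Z := by
  have hbd : ∀ B (n : ℕ), ∀ᵐ ω ∂P, |(a n ω).real B| ≤ 1 := fun B n => ae_of_all _ fun ω => by
    rw [abs_of_nonneg measureReal_nonneg]; exact measureReal_le_one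
  have hZi : ∀ B, MeasurableSet B → Integrable (Z B) P := fun B hB =>
    Integrable.of_bound (hZm B hB) 1 (ae_abs_le_of_tendstoInMeasure (hbd B) (h B hB))
  have hai : ∀ B, MeasurableSet B → ∀ n, Integrable (fun ω => (a n ω).real B) P := fun B hB n =>
    integrable_kernel_real (a n) P hB
  have hnn : ∀ B, MeasurableSet B → ∀ᵐ ω ∂P, 0 ≤ Z B ω := fun B hB => by
    obtain ⟨ns, -, hns⟩ := (h B hB).exists_seq_tendsto_ae
    filter_upwards [hns] with ω hω
    exact ge_of_tendsto' hω fun n => measureReal_nonneg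
  refine ⟨?_, hnn, fun B C hB hC hBC => ?_, fun B hB hanti hinter => ?_⟩
  · obtain ⟨ns, -, hns⟩ := (h _ .univ).exists_seq_tendsto_ae
    filter_upwards [hns] with ω hω
    simp only [probReal_univ] at hω
    exact tendsto_nhds_unique hω tendsto_const_nhds
  · obtain ⟨ns, hns, h1⟩ := exists_seq_tendsto_ae_of_tendstoInMeasure_pair (h B hB) (h C hC)
    obtain ⟨ms, hms, h2⟩ := ((h _ (hB.union hC)).comp hns).exists_seq_tendsto_ae'
    filter_upwards [h1, h2] with ω e1 e2
    refine tendsto_nhds_unique e2 (((e1.1.comp hms).add (e1.2.comp hms)).congr fun i => ?_)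
    exact (measureReal_union (μ := a (ns (ms i)) ω) hBC hC).symm
  -- The averaged measures `P.bind (a n)` converge setwise to B ↦ ∫ Z B, which brings Nikodym's
  -- theorem into play.
  · have hq : ∀ B, MeasurableSet B →
        Tendsto (fun n => (P.bind (a n)).real B) atTop (𝓝 (∫ ω, Z B ω ∂P)) := fun B hB => by
      have hL := tendsto_integral_abs_sub_of_tendstoInMeasure
        (fun n => (hai B hB n).1) (hZm B hB) (hbd B) (h B hB)
      rw [tendsto_iff_norm_sub_tendsto_zero]
      refine squeeze_zero (fun n => norm_nonneg _) (fun n => ?_) hL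
      have hb : (P.bind (a n)).real B = ∫ ω, (a n ω).real B ∂P := by
        rw [Measure.real, Measure.bind_apply hB (a n).aemeasurable]
        exact (integral_toReal (Kernel.measurable_coe (a n) hB).aemeasurable
          (ae_of_all _ fun ω => measure_lt_top _ _)).symm
      rw [hb, ← integral_sub (hai B hB n) (hZi B hB)]
      exact norm_integral_le_integral_norm _
    have hlim := tendsto_zero_of_tendsto_measureReal_of_antitone hq hB hanti hinter
    have hmono : ∀ᵐ ω ∂P, ∀ i j, i ≤ j → Z (B j) ω ≤ Z (B i) ω := by
      refine ae_all_iff.2 fun i => ae_all_iff.2 fun j => ?_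
      obtain ⟨ns, -, h1⟩ :=
        exists_seq_tendsto_ae_of_tendstoInMeasure_pair (h _ (hB i)) (h _ (hB j))
      filter_upwards [h1] with ω hω hij
      exact le_of_tendsto_of_tendsto' hω.2 hω.1 fun n => measureReal_mono (hanti hij)
    -- For an almost surely decreasing nonnegative sequence, integrals tending to 0 force almost
    -- sure convergence to 0.
    refine tendsto_of_integral_tendsto_of_antitone (F := fun _ => 0) (fun k => hZi _ (hB k))
      (integrable_const _) (by simpa using hlim) ?_ (ae_all_iff.2 fun k => hnn _ (hB k))
    filter_upwards [hmono] with ω hω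
    exact fun i j hij => hω i j hij

theorem mainTheorem2 {Ω S : Type*} [MeasurableSpace Ω] [MeasurableSpace S]
    [StandardBorelSpace S] (P : Measure Ω) [IsProbabilityMeasure P]
    (X : ℕ → Ω → S) (hX : ∀ n, Measurable (X n))
    (a : ℕ → Kernel Ω S) (ha : IsPredictiveSequence P X a)
    (hconv : ∀ f : S → ℝ, IsBoundedBorel f →
      ConvergesInProbability P (fun n ω => ∫ x, f x ∂(a n ω))) :
    ∃ α : Kernel Ω S, IsMarkovKernel α ∧
      (∀ B : Set S, MeasurableSet B → Measurable[tailSigma X] (fun ω => α ω B)) ∧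
      ∀ f : S → ℝ, IsBoundedBorel f →
        TendstoInMeasure P (fun n ω => ∫ x, f x ∂(a n ω)) atTop
          (fun ω => ∫ x, f x ∂(α ω)) := by
  obtain ⟨ω₀⟩ := nonempty_of_isProbabilityMeasure P
  have : Nonempty S := ⟨X 0 ω₀⟩
  have hmk := ha.isMarkovKernel
  have htail : tailSigma X ≤ ‹MeasurableSpace Ω› :=
    (iInf_le _ 0).trans (iSup₂_le fun i _ => (hX i).comap_le)
  have hlim : ∀ B : Set S, ∃ Z : Ω → ℝ, MeasurableSet B → Measurable[tailSigma X] Z ∧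
      TendstoInMeasure P (fun n ω => (a n ω).real B) atTop Z := by
    intro B
    by_cases hB : MeasurableSet B
    swap
    · exact ⟨0, fun h => absurd h hB⟩
    have hbb : IsBoundedBorel (B.indicator (1 : S → ℝ)) := by
      refine ⟨measurable_one.indicator hB, 1, fun x => ?_⟩
      by_cases hx : x ∈ B <;> simp [hx]
    obtain ⟨Z₀, hZ₀, h₀⟩ := hconv _ hbb
    simp only [integral_indicator_one hB] at h₀
    obtain ⟨Z, hZ, hZe⟩ := exists_measurable_tailSigma_ae_eq hX
      (Y := fun n => (X n ⁻¹' B).indicator fun _ => (1 : ℝ))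
      (fun i => Measurable.indicator (@measurable_const _ _ _ (_) _) ⟨B, hB, rfl⟩)
      (fun n ω => by by_cases hx : ω ∈ X n ⁻¹' B <;> simp [hx])
      hZ₀.aestronglyMeasurable (h₀.congr_left fun n => ha.ae_eq_condProb n B hB)
    exact ⟨Z, fun _ => ⟨hZ, h₀.congr_right hZe.symm⟩⟩
  choose Z hZ using hlim
  have hZm : ∀ B, MeasurableSet B → AEStronglyMeasurable (Z B) P := fun B hB =>
    ((hZ B hB).1.mono htail le_rfl).aestronglyMeasurable
  -- Here Ω carries the tail σ-field, while the filter is still `ae P` for the ambient one.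
  obtain ⟨κ, hκ, hκZ⟩ := @IsRandomProbability.exists_kernel _ _ _ _ _ (tailSigma X) _ _
    (isRandomProbability_of_tendstoInMeasure hZm fun B hB => (hZ B hB).2) _
    fun B hB => (hZ B hB).1
  -- The same measures, regarded as a kernel for the larger ambient σ-field.
  let α : Kernel Ω S := @Kernel.comap _ _ _ (_) (_) (_) κ id (measurable_id'' htail)
  have hα : IsMarkovKernel α := ⟨fun ω => hκ.isProbabilityMeasure ω⟩
  refine ⟨α, hα, fun B hB => @Kernel.measurable_coe _ _ (_) _ κ _ hB, fun f hf => ?_⟩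
  refine tendstoInMeasure_of_tendsto_integral_abs_sub
    (fun n => hf.integrable_integral_kernel (a n) P) (hf.integrable_integral_kernel α P)
    (tendsto_integral_abs_sub_integral_kernel (fun B hB => ?_) hf)
  refine tendsto_integral_abs_sub_of_tendstoInMeasure (C := 1)
    (fun n => (integrable_kernel_real (a n) P hB).1) (integrable_kernel_real α P hB).1
    (fun n => ae_of_all _ fun ω => ?_) ((hZ B hB).2.congr_right ?_)
  · rw [abs_of_nonneg measureReal_nonneg]; exact measureReal_le_one
  · filter_upwards [hκZ B hB] with ω hω using hω.symm
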